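/- Let $k$ be a field of characteristic $p>0$ and let $P$ be a finite partially ordered set. Let $J(P)$ be the set of poset ideals (down-closed subsets) of $P$, and let $$R=k\Big[\,T\prod_{x\in I}X_x \;\Big|\; I\in J(P)\Big]\subseteq k[T,\,X_x \mid x\in P]$$ be the Hibi ring of $J(P)$, graded by the degree in $T$, with homogeneous maximal ideal $\mathfrak m=R_+$ generated by the monomials $T\prod_{x\in I}X_x$, $I\in J(P)$. For a real number $t\ge 0$ the pair $(R,\mathfrak m^t)$ is called F-pure if for all large $q=p^e$ there is an element $d\in\mathfrak m^{\lceil t(q-1)\rceil}$ such that the $R$-linear map $R\to R^{1/q}$, $1\mapsto d^{1/q}$, splits. The F-pure threshold of $\mathfrak m$ is $$\operatorname{fpt}(\mathfrak m)=\sup\{t\in\mathbb R_{\ge 0} \mid (R,\mathfrak m^t)\text{ is F-pure}\}.$$ Let $\overline P=P\cup\{-\infty,\infty\}$ be $P$ with a new least element $-\infty$ and a new greatest element $\infty$. A chain is a totally ordered subset, and the length of a chain $C$ is $\operatorname{length}(C)=\#C-1$ (so if $P=\emptyset$, its only maximal chain is $\emptyset$, of length $-1$). Then $\operatorname{fpt}(\mathfrak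 m)$ is a (finite) real number, and $$\operatorname{fpt}(\mathfrak m)\ \le\ \min\{\operatorname{length}(C) \mid C \text{ a maximal chain of } \overline P\}\ =\ \min\{\operatorname{length}(C)\mid C\text{ a maximal chain of }P\}+2 .$$ -/

import Mathlib

noncomputable section

/-! ### F-purity of pairs and the F-pure threshold -/

/-- The `R`-algebra `R^{1/q}`, `q = p ^ e`, for a ring `R` of characteristic `p`. It is realised on a
copy of the ring `R`, whose element `d` stands for the root `d^{1/q}`; since `r = (r^q)^{1/q}`,
the structure map `R → R^{1/q}` is the `e`-th iterate of the Frobenius map. -/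
def FrobeniusRoot (R : Type*) (_p _e : ℕ) : Type _ := R

instance (R : Type*) [CommRing R] (p e : ℕ) : CommRing (FrobeniusRoot R p e) :=
  inferInstanceAs (CommRing R)

/-- The ring isomorphism `R ≃ R^{1/q}`, `d ↦ d^{1/q}`. -/
def FrobeniusRoot.root (R : Type*) [CommRing R] (p e : ℕ) : R ≃+* FrobeniusRoot R p e :=
  RingEquiv.refl R

instance (R : Type*) [CommRing R] (p e : ℕ) [ExpChar R p] : Algebra R (FrobeniusRoot R p e) :=
  ((FrobeniusRoot.root R p e : R →+* FrobeniusRoot R p e).comp (iterateFrobenius R p e)).toAlgebra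

/-- In `R^{1/q}` one has `(d^{1/q})^q = d`. -/
theorem FrobeniusRoot.root_pow (R : Type*) [CommRing R] (p e : ℕ) [ExpChar R p] (d : R) :
    FrobeniusRoot.root R p e d ^ p ^ e = algebraMap R (FrobeniusRoot R p e) d := by
  rw [← map_pow]
  rfl

/-- The `R`-linear map `R → R^{1/q}`, `1 ↦ d^{1/q}`, splits. -/
def RootMapSplits (R : Type*) [CommRing R] (p e : ℕ) [ExpChar R p] (d : R) : Prop :=
  ∃ φ : FrobeniusRoot R p e →ₗ[R] R,
    φ ∘ₗ LinearMap.toSpanSingleton R (FrobeniusRoot R p e) (FrobeniusRoot.root R p e d) =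
      LinearMap.id

/-- The pair `(R, 𝔞^t)` is F-pure: for all large `q = p ^ e` there is `d ∈ 𝔞^⌈t(q-1)⌉` such that
`R → R^{1/q}`, `1 ↦ d^{1/q}`, splits. Used for `t ≥ 0` only. -/
def IsFPurePair {R : Type*} [CommRing R] (p : ℕ) [ExpChar R p] (𝔞 : Ideal R) (t : ℝ) : Prop :=
  ∃ e₀ : ℕ, ∀ e ≥ e₀, ∃ d ∈ 𝔞 ^ ⌈t * ((p : ℝ) ^ e - 1)⌉₊, RootMapSplits R p e d

/-- The set of real numbers `t ≥ 0` such that `(R, 𝔞^t)` is F-pure. -/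
def fPureExponents {R : Type*} [CommRing R] (p : ℕ) [ExpChar R p] (𝔞 : Ideal R) : Set ℝ :=
  {t | 0 ≤ t ∧ IsFPurePair p 𝔞 t}

/-- The F-pure threshold of `𝔞`. -/
def fpt {R : Type*} [CommRing R] (p : ℕ) [ExpChar R p] (𝔞 : Ideal R) : ℝ :=
  sSup (fPureExponents p 𝔞)

/-! ### Hibi rings -/

open Classical in
/-- The monomial `T * ∏_{x ∈ I} X_x` of a poset ideal `I`. The variables are indexed by
`Option P`: `none` is the index of `T`, and `some x` is the index of `X_x`. -/
def hibiMonomial (k P : Type*) [Field k] [PartialOrder P] [Fintype P] (I : LowerSet P) :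
    MvPolynomial (Option P) k :=
  MvPolynomial.X none * ∏ x ∈ Finset.univ.filter (· ∈ I), MvPolynomial.X (some x)

/-- The Hibi ring over `k` of the distributive lattice `J(P)` of poset ideals of `P`. -/
abbrev HibiRing (k P : Type*) [Field k] [PartialOrder P] [Fintype P] :
    Subalgebra k (MvPolynomial (Option P) k) :=
  Algebra.adjoin k (Set.range (hibiMonomial k P))

instance (k P : Type*) [Field k] [PartialOrder P] [Fintype P] (p : ℕ) [ExpChar k p] :
    ExpChar (HibiRing k P) p :=
  expChar_of_injective_algebraMap (algebraMap k (HibiRing k P)).injective p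

/-- The algebra generator of the Hibi ring that belongs to the poset ideal `I`. -/
def hibiGenerator (k P : Type*) [Field k] [PartialOrder P] [Fintype P] (I : LowerSet P) :
    HibiRing k P :=
  ⟨hibiMonomial k P I, Algebra.subset_adjoin ⟨I, rfl⟩⟩

/-- The homogeneous maximal ideal `𝔪 = R₊` of the Hibi ring `R`, which is graded by the degree
in `T`. As `R` is generated over `k` in degree one, `𝔪` is generated by the algebra generators. -/
def hibiMaximalIdeal (k P : Type*) [Field k] [PartialOrder P] [Fintype P] :
    Ideal (HibiRing k P) :=
  Ideal.span (Set.range (hibiGenerator k P))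

/-! ### Maximal chains -/

/-- The set of the lengths `#C - 1` of the maximal chains `C` of a poset. (The only maximal chain
of the empty poset is the empty one; its length is `-1`.) -/
def maximalChainLengths (Q : Type*) [PartialOrder Q] : Set ℤ :=
  {l | ∃ C : Set Q, IsMaxChain (· ≤ ·) C ∧ l = (C.ncard : ℤ) - 1}

/-- The poset `P ∪ {-∞, ∞}`, where `-∞` and `∞` are new least and greatest elements. -/
abbrev ExtendedPoset (P : Type*) : Type _ := WithBot (WithTop P)

end

/-!
The monomials in the Hibi ring `R` correspond to the antitone functions `v : P ∪ {-∞, ∞} → ℕ` with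
`v ∞ = 0`, the degree in `T` being `v (-∞)`: such a function is the sum of the indicator functions
of its superlevel sets, which belong to the generators. This monoid is saturated, so `R` is F-pure
and `t = 0` is one of the exponents.

Suppose that `ψ : R^{1/q} → R` splits `1 ↦ d^{1/q}`. Then `ψ` takes the root of some monomial of
`d`, with function `v` say, to an element with nonzero constant term. Such a `v` drops by at most
`q - 1` along each covering relation `x ⋖ y`. Indeed, if `v x - v y ≥ q`, choose a monomial `r`
that is equal at `x` and `y` and drops strictly along all other relations; its `q`-th power times
the monomial of `v` is then divisible by the `q`-th power of a monomial `s` that drops along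
`x ⋖ y`. By linearity of `ψ`, `s` divides `r` in `R`, which is absurd as `r` does not drop along
`x ⋖ y`.

Going down a maximal chain `C`, the monomial of `v` has degree at most `length C * (q - 1)` in `T`.
If `d ∈ 𝔪 ^ ⌈t(q - 1)⌉`, its degree is at least `t(q - 1)`, so `t ≤ length C`.
-/

section Chains

theorem le_add_nsmul_of_isMaxChain {Q M : Type*} [PartialOrder Q] [BoundedOrder Q]
    [AddCommMonoid M] [PartialOrder M] [IsOrderedAddMonoid M] {C : Set Q}
    (hC : IsMaxChain (· ≤ ·) C) {n : ℕ} (hn : C.ncard = n + 1) {v : Q → M} {m : M}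
    (hv : ∀ x y, x ⋖ y → v x ≤ v y + m) : v ⊥ ≤ v ⊤ + n • m := by
  classical
  let F : Flag Q := .ofIsMaxChain C hC
  have : Finite F := Set.finite_of_ncard_pos (hn ▸ n.succ_pos)
  have := Fintype.ofFinite F
  let e : Fin (n + 1) ≃o F :=
    monoEquivOfFin F (Nat.card_eq_fintype_card.symm.trans hn)
  have e_zero : (e 0 : Q) = ⊥ := congrArg Subtype.val e.map_bot
  have e_last : (e (Fin.last n) : Q) = ⊤ := congrArg Subtype.val e.map_top
  have covBy (i : Fin n) : (e i.castSucc : Q) ⋖ e i.succ :=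
    Flag.coe_covBy_coe.2 ((apply_covBy_apply_iff e).2
      ⟨i.castSucc_lt_succ, fun j hij hji => by simp only [Fin.lt_def] at hij hji; grind⟩)
  have bound (i : Fin (n + 1)) : v ⊥ ≤ v (e i) + (i : ℕ) • m := by
    induction i using Fin.induction with
    | zero => simp [e_zero]
    | succ i ih =>
      calc v ⊥ ≤ v (e i.castSucc) + (i : ℕ) • m := ih
        _ ≤ v (e i.succ) + m + (i : ℕ) • m := by gcongr; exact hv _ _ (covBy i)
        _ = v (e i.succ) + (i.succ : ℕ) • m := by rw [Fin.val_succ, succ_nsmul', add_assoc]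
  simpa [e_last] using bound (Fin.last n)

variable {P Q : Type*} [PartialOrder P] [PartialOrder Q] {f : P ↪o Q}

theorem isChain_kernImage (hf : ∀ z ∉ Set.range f, ∀ w, z ≤ w ∨ w ≤ z) {C : Set P}
    (hC : IsChain (· ≤ ·) C) : IsChain (· ≤ ·) (Set.kernImage f C) := by
  intro z hz w hw _
  by_cases hzf : z ∈ Set.range f
  · by_cases hwf : w ∈ Set.range f
    · obtain ⟨x, rfl⟩ := hzf
      obtain ⟨y, rfl⟩ := hwf
      simpa only [f.le_iff_le] using hC.total (hz rfl) (hw rfl)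
    · exact (hf w hwf z).symm
  · exact hf z hzf w

theorem preimage_kernImage_of_injective {α β : Type*} {f : α → β} (hf : f.Injective) (s : Set α) :
    f ⁻¹' Set.kernImage f s = s := by
  rw [Set.kernImage_eq_compl, Set.preimage_compl, hf.preimage_image, compl_compl]

theorem isMaxChain_kernImage (hf : ∀ z ∉ Set.range f, ∀ w, z ≤ w ∨ w ≤ z) {C : Set P}
    (hC : IsMaxChain (· ≤ ·) C) : IsMaxChain (· ≤ ·) (Set.kernImage f C) := by
  refine ⟨isChain_kernImage hf hC.isChain, fun D hD hCD => hCD.antisymm ?_⟩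
  have hCD' : C ⊆ f ⁻¹' D :=
    (preimage_kernImage_of_injective f.injective C).symm.trans_subset (Set.preimage_mono hCD)
  rw [Set.subset_kernImage_iff, ← hC.2 (hD.preimage_embedding f) hCD']

theorem exists_isMaxChain_kernImage_eq (hf : ∀ z ∉ Set.range f, ∀ w, z ≤ w ∨ w ≤ z) {D : Set Q}
    (hD : IsMaxChain (· ≤ ·) D) :
    ∃ C : Set P, IsMaxChain (· ≤ ·) C ∧ Set.kernImage f C = D := by
  have eq_of_subset {C : Set P} (hC : IsChain (· ≤ ·) C) (hDC : f ⁻¹' D ⊆ C) :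
      D = Set.kernImage f C :=
    hD.2 (isChain_kernImage hf hC) (Set.subset_kernImage_iff.2 hDC)
  refine ⟨f ⁻¹' D, ⟨hD.isChain.preimage_embedding f, fun C hC hDC => ?_⟩,
    (eq_of_subset (hD.isChain.preimage_embedding f) subset_rfl).symm⟩
  rw [eq_of_subset hC hDC, preimage_kernImage_of_injective f.injective]

theorem ncard_kernImage {α β : Type*} [Finite β] {f : α → β} (hf : f.Injective) (s : Set α) :
    (Set.kernImage f s).ncard = s.ncard + (Set.range f)ᶜ.ncard := by
  rw [← Set.ncard_inter_add_ncard_sdiff_eq_ncard _ (Set.range f),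
    ← Set.image_preimage_eq_inter_range, preimage_kernImage_of_injective hf,
    Set.ncard_image_of_injective s hf, Set.sdiff_eq,
    Set.inter_eq_right.2 Set.compl_range_subset_kernImage]

theorem maximalChainLengths_eq_image [Finite Q] (hf : ∀ z ∉ Set.range f, ∀ w, z ≤ w ∨ w ≤ z) :
    maximalChainLengths Q = (· + ((Set.range f)ᶜ.ncard : ℤ)) '' maximalChainLengths P := by
  have length_kernImage (C : Set P) :
      ((Set.kernImage f C).ncard : ℤ) - 1 = C.ncard - 1 + (Set.range f)ᶜ.ncard := by
    rw [ncard_kernImage f.injective]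
    push_cast
    ring
  ext l
  constructor
  · rintro ⟨_, hD, rfl⟩
    obtain ⟨C, hC, rfl⟩ := exists_isMaxChain_kernImage_eq hf hD
    exact ⟨_, ⟨C, hC, rfl⟩, (length_kernImage C).symm⟩
  · rintro ⟨_, ⟨C, hC, rfl⟩, rfl⟩
    exact ⟨_, isMaxChain_kernImage hf hC, (length_kernImage C).symm⟩

/-- The inclusion of `P` into `P ∪ {-∞, ∞}`. -/
def toExtendedPoset (P : Type*) [PartialOrder P] : P ↪o ExtendedPoset P :=
  WithTop.coeOrderHom.trans WithBot.coeOrderHom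

theorem compl_range_toExtendedPoset : (Set.range (toExtendedPoset P))ᶜ = {⊥, ⊤} := by
  ext z
  induction z using WithBot.recBotCoe with
  | bot => simp [toExtendedPoset]
  | coe z =>
    induction z using WithTop.recTopCoe with
    | top => simp [toExtendedPoset, ← WithBot.coe_top]
    | coe x => simp [toExtendedPoset, ← WithBot.coe_top]

theorem maximalChainLengths_extendedPoset [Finite P] :
    maximalChainLengths (ExtendedPoset P) = (· + 2) '' maximalChainLengths P := by
  have hcomp (z : ExtendedPoset P) (hz : z ∉ Set.range (toExtendedPoset P)) (w) :
      z ≤ w ∨ w ≤ z := by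
    rw [← Set.mem_compl_iff, compl_range_toExtendedPoset] at hz
    rcases hz with rfl | rfl
    exacts [Or.inl bot_le, Or.inr le_top]
  have := maximalChainLengths_eq_image hcomp
  rwa [compl_range_toExtendedPoset, Set.ncard_pair bot_ne_top] at this

theorem exists_isLeast_maximalChainLengths (Q : Type*) [PartialOrder Q] :
    ∃ l, IsLeast (maximalChainLengths Q) l := by
  obtain ⟨C, hC, -⟩ := (IsChain.empty (α := Q) (r := (· ≤ ·))).exists_maxChain
  have hbdd : BddBelow (maximalChainLengths Q) := ⟨-1, by rintro _ ⟨D, -, rfl⟩; omega⟩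
  exact ⟨_, Int.csInf_mem ⟨_, C, hC, rfl⟩ hbdd, fun _ hl => csInf_le hbdd hl⟩

end Chains

section Facets

variable {Q : Type*} [PartialOrder Q]

/-- The monoid of the antitone maps `Q → ℕ` that vanish at `⊤`. For `Q = P ∪ {-∞, ∞}` its elements
are the exponent vectors of the monomials of the Hibi ring, and the covering relations `x ⋖ y` of
`Q` correspond to the facets `v x = v y` of the cone that these vectors span. -/
def antitoneZeroTop (Q : Type*) [PartialOrder Q] [OrderTop Q] : AddSubmonoid (Q → ℕ) where
  carrier := {v | Antitone v ∧ v ⊤ = 0}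
  zero_mem' := ⟨antitone_const, rfl⟩
  add_mem' hv hw := ⟨hv.1.add hw.1, by simp [hv.2, hw.2]⟩

theorem mem_antitoneZeroTop_of_nsmul_mem [OrderTop Q] {n : ℕ} (hn : n ≠ 0) {v : Q → ℕ}
    (hv : n • v ∈ antitoneZeroTop Q) : v ∈ antitoneZeroTop Q :=
  ⟨fun _ _ h => Nat.le_of_mul_le_mul_left (hv.1 h) hn.bot_lt, by simpa [hn] using hv.2⟩

/-- The sum of the indicator functions of all lower sets that omit `⊤` and do not separate `x` from
`y`: a point in the relative interior of the facet `v x = v y`. -/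
noncomputable def facetWeight [OrderTop Q] (x y z : Q) : ℕ :=
  {I : LowerSet Q | z ∈ I ∧ ⊤ ∉ I ∧ (x ∈ I → y ∈ I)}.ncard

theorem facetWeight_mem_antitoneZeroTop [OrderTop Q] [Finite Q] (x y : Q) :
    facetWeight x y ∈ antitoneZeroTop Q := by
  refine ⟨fun z w hzw => Set.ncard_le_ncard fun I hI => ⟨I.lower hzw hI.1, hI.2⟩, ?_⟩
  rw [facetWeight, Set.ncard_eq_zero]
  exact Set.eq_empty_of_forall_notMem fun I hI => hI.2.1 hI.1

theorem facetWeight_left_eq_right [OrderTop Q] {x y : Q} (hxy : x ≤ y) :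
    facetWeight x y x = facetWeight x y y :=
  congrArg Set.ncard <| Set.ext fun I =>
    ⟨fun hI => ⟨hI.2.2 hI.1, hI.2⟩, fun hI => ⟨I.lower hxy hI.1, hI.2⟩⟩

theorem facetWeight_lt [OrderTop Q] [Finite Q] {x y z w : Q} (hxy : x ⋖ y) (hzw : z < w)
    (hne : ¬(z = x ∧ w = y)) : facetWeight x y w < facetWeight x y z := by
  obtain ⟨I, hzI, hwI, hxyI⟩ : ∃ I : LowerSet Q, z ∈ I ∧ w ∉ I ∧ (x ∈ I → y ∈ I) := by
    by_cases hz : x ≤ z → y ≤ z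
    · exact ⟨LowerSet.Iic z, le_rfl, hzw.not_ge, hz⟩
    · refine ⟨(UpperSet.Ici w).compl, hzw.not_ge, not_not_intro le_rfl, fun _ (hwy : w ≤ y) => ?_⟩
      push Not at hz
      have hzx : z = x := (hxy.eq_or_eq hz.1 (hzw.le.trans hwy)).resolve_right
        fun h => hz.2 h.ge
      exact hne ⟨hzx, (hxy.eq_or_eq (hzx ▸ hzw.le) hwy).resolve_left (hzx ▸ hzw.ne')⟩
  have htop : ⊤ ∉ I := fun h => hwI (I.lower le_top h)
  exact Set.ncard_lt_ncard ⟨fun J hJ => ⟨J.lower hzw.le hJ.1, hJ.2⟩,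
    fun h => hwI (h ⟨hzI, htop, hxyI⟩).1⟩

theorem exists_add_eq_of_forall_lt [OrderTop Q] {v w : Q → ℕ} (hv : v ⊤ = 0) (hw : w ⊤ = 0)
    (h : ∀ ⦃z z'⦄, z < z' → w z' + v z ≤ w z + v z') :
    ∃ u ∈ antitoneZeroTop Q, v + u = w := by
  have hle (z : Q) : v z ≤ w z := by
    rcases eq_or_ne z ⊤ with rfl | hz
    · rw [hv, hw]
    · simpa [hv, hw] using h hz.lt_top
  refine ⟨w - v, ⟨fun z z' hzz' => ?_, by simp [hw]⟩, funext fun z => by simp [hle z]⟩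
  rcases hzz'.eq_or_lt with rfl | hlt
  · exact le_rfl
  · have := h hlt
    have := hle z
    have := hle z'
    simp only [Pi.sub_apply]
    omega

/-- The height of `v` over the facet of `x ⋖ y` is `v x - v y`. As `r` lies in the relative
interior of this facet, its height over every other facet is positive, which makes room for
subtracting `q • s` from `q • r + v`. -/
theorem exists_nsmul_add_eq_of_covBy [OrderTop Q] [Finite Q] {x y : Q} (hxy : x ⋖ y) {q : ℕ}
    {v : Q → ℕ} (hv : v ∈ antitoneZeroTop Q) (hq : v y + q ≤ v x) :
    ∃ r ∈ antitoneZeroTop Q, ∃ s ∈ antitoneZeroTop Q, ∃ u ∈ antitoneZeroTop Q,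
      q • s + u = q • r + v ∧ r x = r y ∧ s y < s x := by
  classical
  let r := facetWeight x y
  let s (z : Q) : ℕ := if z ≤ x then 1 else 0
  have hr : r ∈ antitoneZeroTop Q := facetWeight_mem_antitoneZeroTop x y
  have hrxy : r x = r y := facetWeight_left_eq_right hxy.le
  have hsx : s x = 1 := if_pos le_rfl
  have hsy : s y = 0 := if_neg hxy.lt.not_ge
  have hs : s ∈ antitoneZeroTop Q :=
    ⟨fun z w hzw => by simp only [s]; grind, if_neg fun h => (hxy.lt.trans_le le_top).not_ge h⟩
  have hdrop {z w : Q} (hzw : z < w) :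
      q * r w + v w + q * s z ≤ q * r z + v z + q * s w := by
    by_cases h : z = x ∧ w = y
    · obtain ⟨rfl, rfl⟩ := h
      rw [hsx, hsy, hrxy]
      omega
    · have hrs : r w + s z ≤ r z + s w := by
        have : r w < r z := facetWeight_lt hxy hzw h
        have : s z ≤ 1 := by simp only [s]; grind
        omega
      have := hv.1 hzw.le
      nlinarith
  obtain ⟨u, hu, hsu⟩ := exists_add_eq_of_forall_lt (v := q • s) (w := q • r + v)
    (by simp [hs.2]) (by simp [hr.2, hv.2]) fun _ _ => hdrop
  exact ⟨r, hr, s, hs, u, hu, hsu, hrxy, by omega⟩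

end Facets
section RootMap

variable {p e : ℕ}

theorem rootMapSplits_iff_exists_addMonoidHom {R : Type*} [CommRing R] [ExpChar R p] {d : R} :
    RootMapSplits R p e d ↔
      ∃ ψ : R →+ R, (∀ r s, ψ (r ^ p ^ e * s) = r * ψ s) ∧ ψ d = 1 := by
  constructor
  · rintro ⟨φ, hφ⟩
    refine ⟨φ.toAddMonoidHom.comp (FrobeniusRoot.root R p e : R →+ FrobeniusRoot R p e),
      fun r s => φ.map_smul r (FrobeniusRoot.root R p e s), ?_⟩
    simpa using LinearMap.congr_fun hφ 1
  · rintro ⟨ψ, hψ, hd⟩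
    let φ : FrobeniusRoot R p e →ₗ[R] R :=
      { toFun := fun s => ψ ((FrobeniusRoot.root R p e).symm s)
        map_add' := fun s t => by rw [map_add, map_add]
        map_smul' := fun r s => hψ r ((FrobeniusRoot.root R p e).symm s) }
    refine ⟨φ, LinearMap.ext_ring ?_⟩
    rw [LinearMap.comp_apply, LinearMap.toSpanSingleton_apply, one_smul]
    exact hd

theorem rootMapSplits_one_of_field (k : Type*) [Field k] (p e : ℕ) [ExpChar k p] :
    RootMapSplits k p e 1 := by
  have : Nontrivial (FrobeniusRoot k p e) := inferInstanceAs (Nontrivial k)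
  refine LinearMap.exists_leftInverse_of_injective _ (LinearMap.ker_eq_bot.2 fun a b hab => ?_)
  exact (algebraMap k (FrobeniusRoot k p e)).injective (by simpa [Algebra.smul_def] using hab)

end RootMap

section MonomialSubalgebra

open MvPolynomial

variable {σ k : Type*}

/-- The additive map of polynomials that sends `c X ^ (n • a)` to `τ c X ^ a` and kills the
monomials whose exponent vector is not divisible by `n`. It extends a map `τ` that splits an iterate
of the Frobenius map of `k`, `n = p ^ e`, to the polynomial ring. -/
noncomputable def rootMap [CommSemiring k] (τ : k →+ k) (n : ℕ) [NeZero n] :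
    MvPolynomial σ k →+ MvPolynomial σ k where
  toFun f := AddMonoidAlgebra.map τ
    (AddMonoidAlgebra.comapDomain (n • ·) (nsmul_right_injective (NeZero.ne n)) f)
  map_zero' := by simp
  map_add' f g := by rw [AddMonoidAlgebra.comapDomain_add, AddMonoidAlgebra.map_add]

theorem coeff_rootMap [CommSemiring k] (τ : k →+ k) (n : ℕ) [NeZero n] (f : MvPolynomial σ k)
    (a : σ →₀ ℕ) : coeff a (rootMap τ n f) = τ (coeff (n • a) f) :=
  rfl

theorem rootMap_pow_mul [CommRing k] {p e : ℕ} [ExpChar k p] [NeZero (p ^ e)] {τ : k →+ k}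
    (hτ : ∀ r s, τ (r ^ p ^ e * s) = r * τ s) (g f : MvPolynomial σ k) :
    rootMap τ (p ^ e) (g ^ p ^ e * f) = g * rootMap τ (p ^ e) f := by
  induction g using MvPolynomial.induction_on' with
  | add g h hg hh => rw [add_pow_expChar_pow, add_mul, map_add, hg, hh, add_mul]
  | monomial m c =>
    ext a
    have hle : p ^ e • m ≤ p ^ e • a ↔ m ≤ a :=
      forall_congr' fun i => Nat.mul_le_mul_left_iff (NeZero.pos _)
    have hsub : p ^ e • a - p ^ e • m = p ^ e • (a - m) := by
      ext i
      simp [Nat.mul_sub]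
    rw [coeff_rootMap, monomial_pow, coeff_monomial_mul', coeff_monomial_mul', coeff_rootMap,
      apply_ite τ, hτ, map_zero, hsub]
    simp only [hle]

theorem rootMap_one [CommSemiring k] {n : ℕ} [NeZero n] {τ : k →+ k} (hτ : τ 1 = 1) :
    rootMap τ n (1 : MvPolynomial σ k) = 1 := by
  classical
  ext a
  rw [coeff_rootMap, coeff_one, coeff_one, apply_ite τ, hτ, map_zero]
  simp only [eq_comm (a := (0 : σ →₀ ℕ)), smul_eq_zero_iff_right (NeZero.ne n)]

theorem rootMapSplits_one_of_toSubmodule_eq_restrictSupport [CommRing k]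
    {A : Subalgebra k (MvPolynomial σ k)} {S : Set (σ →₀ ℕ)}
    (hA : Subalgebra.toSubmodule A = restrictSupport k S) {p e : ℕ} [ExpChar k p] [ExpChar A p]
    (hk : RootMapSplits k p e 1) (hS : ∀ a, p ^ e • a ∈ S → a ∈ S) : RootMapSplits A p e 1 := by
  have : NeZero (p ^ e) := ⟨(pow_pos (expChar_pos k p) e).ne'⟩
  obtain ⟨τ, hτ, hτ1⟩ := rootMapSplits_iff_exists_addMonoidHom.1 hk
  have hmem (f : A) : rootMap τ (p ^ e) f.1 ∈ A := by
    refine hA.ge fun a (ha : a ∈ (rootMap τ (p ^ e) f.1).support) => hS a (hA.le f.2 ?_)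
    change p ^ e • a ∈ f.1.support
    rw [mem_support_iff, coeff_rootMap] at ha
    exact mem_support_iff.2 fun h => ha (by rw [h, map_zero])
  exact rootMapSplits_iff_exists_addMonoidHom.2
    ⟨AddMonoidHom.mk' (fun f => ⟨rootMap τ (p ^ e) f.1, hmem f⟩)
      fun f g => Subtype.ext (map_add _ f.1 g.1),
    fun g f => Subtype.ext (rootMap_pow_mul hτ g.1 f.1), Subtype.ext (rootMap_one hτ1)⟩

variable [CommSemiring k] {A : Subalgebra k (MvPolynomial σ k)} {S : Set (σ →₀ ℕ)}

theorem exists_monomial_apply_ne_zero (hA : Subalgebra.toSubmodule A = restrictSupport k S)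
    {M : Type*} [AddCommMonoid M] (φ : A →+ M) {f : A} (hf : φ f ≠ 0) :
    ∃ a ∈ f.1.support, ∃ (c : k) (g : A), g.1 = monomial a c ∧ φ g ≠ 0 := by
  have mem (a : f.1.support) : monomial a.1 (coeff a.1 f.1) ∈ A :=
    hA.ge ((monomial_mem_restrictSupport k).2 (Or.inl (hA.le f.2 a.2)))
  have hsum : f = ∑ a : f.1.support, ⟨monomial a.1 (coeff a.1 f.1), mem a⟩ := by
    refine Subtype.ext ?_
    rw [AddSubmonoidClass.coe_finsetSum,
      Finset.sum_coe_sort f.1.support fun a => monomial a (coeff a f.1)]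
    exact f.1.as_sum
  rw [hsum, map_sum] at hf
  obtain ⟨a, -, ha⟩ := Finset.exists_ne_zero_of_sum_ne_zero hf
  exact ⟨a.1, a.2, _, _, rfl, ha⟩

/-- Compare the coefficients of `X ^ r` in `X ^ s * ψ (c X ^ u) = X ^ r * ψ (c X ^ a)`. -/
theorem exists_add_eq_of_coeff_zero_ne_zero (hA : Subalgebra.toSubmodule A = restrictSupport k S)
    {q : ℕ} {ψ : A →+ A} (hψ : ∀ f g, ψ (f ^ q * g) = f * ψ g) {a : σ →₀ ℕ} {c : k} {f : A}
    (hf : f.1 = monomial a c) (hψf : coeff 0 (ψ f).1 ≠ 0) {r s u : σ →₀ ℕ} (hr : r ∈ S)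
    (hs : s ∈ S) (hu : u ∈ S) (h : q • s + u = q • r + a) : ∃ t ∈ S, s + t = r := by
  have mem {m : σ →₀ ℕ} (hm : m ∈ S) (b : k) : monomial m b ∈ A :=
    hA.ge ((monomial_mem_restrictSupport k).2 (Or.inl hm))
  let X_r : A := ⟨monomial r 1, mem hr 1⟩
  let X_s : A := ⟨monomial s 1, mem hs 1⟩
  let cX_u : A := ⟨monomial u c, mem hu c⟩
  have hmul : X_s ^ q * cX_u = X_r ^ q * f := by
    refine Subtype.ext ?_
    change monomial s 1 ^ q * monomial u c = monomial r 1 ^ q * f.1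
    rw [hf, monomial_pow, monomial_pow, monomial_mul, monomial_mul, h, one_pow]
  have hψmul : X_s * ψ cX_u = X_r * ψ f := by rw [← hψ, ← hψ, hmul]
  have hcoeff : coeff r (monomial s 1 * (ψ cX_u).1) = coeff 0 (ψ f).1 := by
    have := congrArg (coeff r ∘ Subtype.val) hψmul
    simpa [X_r, X_s, coeff_monomial_mul'] using this
  rw [← hcoeff, coeff_monomial_mul', one_mul, ite_ne_right_iff] at hψf
  exact ⟨r - s, hA.le (ψ cX_u).2 (mem_support_iff.2 hψf.2), add_tsub_cancel_of_le hψf.1⟩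

end MonomialSubalgebra

section HibiRing

open MvPolynomial

variable {k P : Type*}

/-- The exponent vector `a` as a function on `P ∪ {-∞, ∞}`: the value at `-∞` is the exponent of
`T`, and the value at `∞` is `0`. -/
noncomputable def extendExponent : (Option P →₀ ℕ) →+ (ExtendedPoset P → ℕ) where
  toFun a := WithBot.recBotCoe (a none) (WithTop.recTopCoe 0 fun x => a (some x))
  map_zero' := by simp [funext_iff, WithBot.forall, WithTop.forall]
  map_add' _ _ := by simp [funext_iff, WithBot.forall, WithTop.forall]

theorem extendExponent_injective : Function.Injective (extendExponent (P := P)) := fun _ _ hab =>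
  Finsupp.ext fun
    | none => congrFun hab ⊥
    | some x => congrFun hab ((x : WithTop P) : ExtendedPoset P)

theorem exists_extendExponent_eq [Finite P] {v : ExtendedPoset P → ℕ} (hv : v ⊤ = 0) :
    ∃ a : Option P →₀ ℕ, extendExponent a = v := by
  refine ⟨Finsupp.equivFunOnFinite.symm fun i =>
    i.elim (v ⊥) fun x => v ((x : WithTop P) : ExtendedPoset P), ?_⟩
  simp only [funext_iff, WithBot.forall, WithTop.forall]
  exact ⟨rfl, hv.symm, fun x => rfl⟩

variable [Field k] [PartialOrder P]

/-- The monoid of the exponent vectors of the monomials in the Hibi ring. -/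
noncomputable def hibiCone (P : Type*) [PartialOrder P] : AddSubmonoid (Option P →₀ ℕ) :=
  (antitoneZeroTop (ExtendedPoset P)).comap extendExponent

theorem mem_hibiCone_iff {a : Option P →₀ ℕ} :
    a ∈ hibiCone P ↔ (Antitone fun x => a (some x)) ∧ ∀ x, a (some x) ≤ a none := by
  have hbot : extendExponent a ⊥ = a none := rfl
  have htop : extendExponent a ⊤ = 0 := rfl
  have hcoe (x : P) : extendExponent a ((x : WithTop P) : ExtendedPoset P) = a (some x) := rfl
  have hanti : Antitone (extendExponent a) ↔
      (Antitone fun x => a (some x)) ∧ ∀ x, a (some x) ≤ a none := by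
    rw [← monotone_toDual_comp_iff, WithBot.monotone_iff, WithTop.monotone_iff]
    simp only [Monotone, Antitone, WithTop.forall, Function.comp_apply, OrderDual.toDual_le_toDual,
      WithBot.coe_top, hbot, htop, hcoe, zero_le, implies_true, and_true, true_and]
  exact (and_iff_left htop).trans hanti

open Classical in
/-- The exponent vector of the generator of the Hibi ring that belongs to `I`. -/
noncomputable def hibiExponent [Finite P] (I : LowerSet P) : Option P →₀ ℕ :=
  Finsupp.equivFunOnFinite.symm fun i => i.elim 1 fun x => if x ∈ I then 1 else 0

theorem hibiExponent_mem_hibiCone [Finite P] (I : LowerSet P) : hibiExponent I ∈ hibiCone P := by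
  refine mem_hibiCone_iff.2 ⟨fun x y hxy => ?_, fun x => ?_⟩
  · have : y ∈ I → x ∈ I := fun hy => I.lower hxy hy
    simp only [hibiExponent, Finsupp.equivFunOnFinite_symm_apply_apply, Option.elim_some]
    grind
  · simp only [hibiExponent, Finsupp.equivFunOnFinite_symm_apply_apply, Option.elim]
    grind

theorem hibiCone_eq_closure [Finite P] :
    hibiCone P = AddSubmonoid.closure (Set.range (hibiExponent (P := P))) := by
  refine le_antisymm (fun a ha => ?_)
    (AddSubmonoid.closure_le.2 (Set.range_subset_iff.2 hibiExponent_mem_hibiCone))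
  obtain ⟨hanti, hle⟩ := mem_hibiCone_iff.1 ha
  let I (i : ℕ) : LowerSet P :=
    ⟨{x | i < a (some x)}, fun x y hyx hx => lt_of_lt_of_le hx (hanti hyx)⟩
  have mem_I (i : ℕ) (x : P) : x ∈ I i ↔ i < a (some x) := Iff.rfl
  have hsum : a = ∑ i ∈ Finset.range (a none), hibiExponent (I i) := by
    ext (_ | x)
    · simp [hibiExponent]
    · have : (Finset.range (a none)).filter (· < a (some x)) = Finset.range (a (some x)) := by
        ext i
        simpa using fun hi : i < a (some x) => hi.trans_le (hle x)
      simp [hibiExponent, mem_I, this]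
  rw [hsum]
  exact sum_mem fun i _ => AddSubmonoid.subset_closure ⟨I i, rfl⟩

theorem hibiMonomial_eq_monomial (k : Type*) [Field k] [Fintype P] (I : LowerSet P) :
    hibiMonomial k P I = monomial (hibiExponent I) 1 := by
  classical
  rw [monomial_eq, C_1, one_mul, Finsupp.prod_fintype _ _ fun i => pow_zero _, Fintype.prod_option,
    hibiMonomial, Finset.prod_filter]
  simp [hibiExponent]

theorem toSubmodule_hibiRing [Fintype P] :
    Subalgebra.toSubmodule (HibiRing k P) = restrictSupport k (hibiCone P) := by
  have hrange : Set.range (hibiMonomial k P) =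
      monomialOneHom k (Option P) '' (Multiplicative.toAdd ⁻¹' Set.range hibiExponent) := by
    ext f
    simp only [Set.mem_range, hibiMonomial_eq_monomial, Set.mem_image, Set.mem_preimage,
      Multiplicative.exists, toAdd_ofAdd, exists_exists_eq_and]
    rfl
  rw [Algebra.adjoin_eq_span, hrange, ← MonoidHom.map_mclosure, ← AddSubmonoid.toSubmonoid_closure,
    ← hibiCone_eq_closure, restrictSupport_eq_span]
  rfl

theorem le_of_mem_hibiMaximalIdeal_pow [Fintype P] {n : ℕ} {f : HibiRing k P}
    (hf : f ∈ hibiMaximalIdeal k P ^ n) {a : Option P →₀ ℕ} (ha : a ∈ f.1.support) :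
    n ≤ a none := by
  have hle : hibiMaximalIdeal k P ≤ (Ideal.span {X none}).comap (HibiRing k P).val := by
    rw [hibiMaximalIdeal, Ideal.span_le]
    rintro _ ⟨I, rfl⟩
    exact Ideal.mem_span_singleton.2 (Dvd.intro _ rfl)
  have hmem : f.1 ∈ Ideal.span {X none} ^ n :=
    Ideal.le_comap_pow _ n (Ideal.pow_right_mono hle n hf)
  rw [Ideal.span_singleton_pow, X_pow_eq_monomial,
    ← Set.image_singleton (f := fun s => monomial s (1 : k)), mem_ideal_span_monomial_image] at hmem
  simpa using hmem a ha

theorem rootMapSplits_one_hibiRing [Fintype P] (p e : ℕ) [ExpChar k p] :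
    RootMapSplits (HibiRing k P) p e 1 := by
  refine rootMapSplits_one_of_toSubmodule_eq_restrictSupport toSubmodule_hibiRing
    (rootMapSplits_one_of_field k p e) fun a ha => ?_
  refine mem_antitoneZeroTop_of_nsmul_mem (pow_pos (expChar_pos k p) e).ne' ?_
  rw [← map_nsmul]
  exact ha

theorem extendExponent_lt_of_covBy [Fintype P] {q : ℕ} {ψ : HibiRing k P →+ HibiRing k P}
    (hψ : ∀ f g, ψ (f ^ q * g) = f * ψ g) {a : Option P →₀ ℕ} (ha : a ∈ hibiCone P) {c : k}
    {f : HibiRing k P} (hf : f.1 = monomial a c) (hψf : coeff 0 (ψ f).1 ≠ 0)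
    {x y : ExtendedPoset P} (hxy : x ⋖ y) : extendExponent a x < extendExponent a y + q := by
  by_contra! hle
  obtain ⟨r, hr, s, hs, u, hu, hrel, hrxy, hsxy⟩ := exists_nsmul_add_eq_of_covBy hxy ha hle
  obtain ⟨r, rfl⟩ := exists_extendExponent_eq hr.2
  obtain ⟨s, rfl⟩ := exists_extendExponent_eq hs.2
  obtain ⟨u, rfl⟩ := exists_extendExponent_eq hu.2
  have hrel' : q • s + u = q • r + a := extendExponent_injective (by simpa using hrel)
  obtain ⟨t, ht, rfl⟩ :=
    exists_add_eq_of_coeff_zero_ne_zero toSubmodule_hibiRing hψ hf hψf hr hs hu hrel'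
  have htxy : extendExponent t y ≤ extendExponent t x := ht.1 hxy.le
  simp only [map_add, Pi.add_apply] at hrxy
  omega

theorem le_mul_of_rootMapSplits [Fintype P] {p e : ℕ} [ExpChar k p] {n l : ℕ} {d : HibiRing k P}
    (hd : d ∈ hibiMaximalIdeal k P ^ n) (hsplit : RootMapSplits (HibiRing k P) p e d)
    {C : Set (ExtendedPoset P)} (hC : IsMaxChain (· ≤ ·) C) (hl : C.ncard = l + 1) :
    n ≤ l * (p ^ e - 1) := by
  obtain ⟨ψ, hψ, hψd⟩ := rootMapSplits_iff_exists_addMonoidHom.1 hsplit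
  let φ : HibiRing k P →+ k :=
    (lcoeff k 0).toAddMonoidHom.comp ((HibiRing k P).val.toLinearMap.toAddMonoidHom.comp ψ)
  have hφd : φ d ≠ 0 := by
    change coeff 0 (ψ d).1 ≠ 0
    simp [hψd]
  obtain ⟨a, had, c, f, hf, hφf⟩ := exists_monomial_apply_ne_zero toSubmodule_hibiRing φ hφd
  have ha : a ∈ hibiCone P := toSubmodule_hibiRing.le d.2 had
  calc n ≤ extendExponent a ⊥ := le_of_mem_hibiMaximalIdeal_pow hd had
    _ ≤ extendExponent a ⊤ + l • (p ^ e - 1) :=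
      le_add_nsmul_of_isMaxChain hC hl fun x y hxy => by
        have := extendExponent_lt_of_covBy hψ ha hf hφf hxy
        omega
    _ = l * (p ^ e - 1) := by rw [ha.2, zero_add, smul_eq_mul]

end HibiRing

section FPurity

variable {k : Type*} [Field k] {p : ℕ} [Fact p.Prime] [CharP k p]
  {P : Type*} [PartialOrder P] [Fintype P]

theorem zero_mem_fPureExponents : 0 ∈ fPureExponents p (hibiMaximalIdeal k P) :=
  ⟨le_rfl, 0, fun e _ => ⟨1, by simp, rootMapSplits_one_hibiRing p e⟩⟩

theorem le_of_mem_fPureExponents {t : ℝ} (ht : t ∈ fPureExponents p (hibiMaximalIdeal k P)) {l : ℤ}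
    (hl : l ∈ maximalChainLengths (ExtendedPoset P)) : t ≤ l := by
  obtain ⟨C, hC, rfl⟩ := hl
  obtain ⟨n, hn⟩ : ∃ n, C.ncard = n + 1 :=
    Nat.exists_eq_succ_of_ne_zero (Set.ncard_ne_zero_of_mem hC.bot_mem)
  obtain ⟨-, e₀, he₀⟩ := ht
  obtain ⟨d, hd, hsplit⟩ := he₀ (e₀ + 1) (Nat.le_succ _)
  have hle := le_mul_of_rootMapSplits hd hsplit hC hn
  have hq : 1 < p ^ (e₀ + 1) := Nat.one_lt_pow (Nat.succ_ne_zero _) (Fact.out : p.Prime).one_lt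
  have hq' : (0 : ℝ) < (p : ℝ) ^ (e₀ + 1) - 1 := sub_pos.2 (mod_cast hq)
  refine le_of_mul_le_mul_right ?_ hq'
  calc t * ((p : ℝ) ^ (e₀ + 1) - 1) ≤ ⌈t * ((p : ℝ) ^ (e₀ + 1) - 1)⌉₊ := Nat.le_ceil _
    _ ≤ ((n * (p ^ (e₀ + 1) - 1) : ℕ) : ℝ) := Nat.cast_le.2 hle
    _ = (((C.ncard : ℤ) - 1 : ℤ) : ℝ) * ((p : ℝ) ^ (e₀ + 1) - 1) := by
      rw [hn]
      push_cast [hq.le]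
      ring

end FPurity

theorem corollary3p8 (k : Type*) [Field k] (p : ℕ) [Fact p.Prime] [CharP k p]
    (P : Type*) [PartialOrder P] [Fintype P] :
    IsLUB (fPureExponents p (hibiMaximalIdeal k P)) (fpt p (hibiMaximalIdeal k P)) ∧
    ∃ l l' : ℤ,
      IsLeast (maximalChainLengths (ExtendedPoset P)) l ∧
      IsLeast (maximalChainLengths P) l' ∧
      fpt p (hibiMaximalIdeal k P) ≤ (l : ℝ) ∧
      l = l' + 2 := by
  obtain ⟨l', hl'⟩ := exists_isLeast_maximalChainLengths P
  have hl : IsLeast (maximalChainLengths (ExtendedPoset P)) (l' + 2) := by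
    rw [maximalChainLengths_extendedPoset]
    exact (add_left_mono (a := (2 : ℤ))).map_isLeast hl'
  have hne : (fPureExponents p (hibiMaximalIdeal k P)).Nonempty := ⟨0, zero_mem_fPureExponents⟩
  have hle : ∀ t ∈ fPureExponents p (hibiMaximalIdeal k P), t ≤ ((l' + 2 : ℤ) : ℝ) :=
    fun t ht => le_of_mem_fPureExponents ht hl.1
  exact ⟨isLUB_csSup hne ⟨_, hle⟩, l' + 2, l', hl, hl', csSup_le hne hle, rfl⟩
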